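/- For $p\in(0,1)$ let $\mathcal A$ be a random set of positive integers in which each positive integer $n$ is included with probability $p$, these events being mutually independent, and let $\mathcal S(p)=\langle\mathcal A\rangle\subseteq\mathbb N=\{0,1,2,\dots\}$ be the set of all finite sums (including the empty sum $0$) of elements of $\mathcal A$. For a cofinite $\mathcal S\subseteq\mathbb N$ that contains $0$ and is closed under addition (a numerical semigroup), let the embedding dimension $\mathrm e(\mathcal S)$ be the number of elements of its unique minimal generating set, let the genus $\mathrm g(\mathcal S)$ be the number of elements of $\mathbb N\setminus\mathcal S$, and let the Frobenius number $\mathrm F(\mathcal S)$ be the largest integer not in $\mathcal S$ (so that $\mathrm F(\mathbb N)=-1$). Theorem. For every $p\in(0,1)$, $\mathcal S(p)$ is almost surely a numerical semigroup, and $\mathrm e(\mathcal S(p))$, $\mathrm g(\mathcal S(p))$, $\mathrm F(\mathcal S(p))$ have finite expectations. As $p\to0^+$, $$\mathrm E[\mathrm e(\mathcal S(p))]=O\!\left(\left(\ln\tfrac1p\right)^3\right),\qquad \mathrm E[\mathrm F(\mathcal S(p))]=O\!\left(\tfrac1p\left(\ln\tfrac1p\right)^3\right),$$ and $\mathrm E[\mathrm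 g(\mathcal S(p))]\le \mathrm E[\mathrm F(\mathcal S(p))]$ for all sufficiently small $p>0$. -/

import Mathlib

open MeasureTheory Filter Topology Asymptotics
open scoped unitInterval

namespace RandomSemigroup

/-- A submonoid of `ℕ` (a subset containing `0` and closed under addition) is a *numerical
semigroup* if it is cofinite. -/
def IsNumericalSemigroup (S : AddSubmonoid ℕ) : Prop :=
  ((S : Set ℕ)ᶜ).Finite

/-- The set of *gaps* of `S`: the natural numbers that are not in `S`. -/
def gaps (S : AddSubmonoid ℕ) : Set ℕ :=
  (S : Set ℕ)ᶜ

/-- The *genus*: the number of gaps (meaningful when `S` is cofinite). -/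
noncomputable def genus (S : AddSubmonoid ℕ) : ℕ :=
  (gaps S).ncard

/-- The *Frobenius number*: the largest integer that is not in `S` (meaningful when `S` is
cofinite). It is the largest gap of `S` if `S ≠ ℕ`, and it is `-1` for `S = ℕ`. -/
noncomputable def frobenius (S : AddSubmonoid ℕ) : ℤ :=
  sSup {z : ℤ | ∀ n ∈ S, (n : ℤ) ≠ z}

/-- The *minimal generators*: the nonzero elements of `S` that are not sums of two nonzero
elements of `S`. They form the least generating set, see `isLeast_minimalGenerators`. -/
def minimalGenerators (S : AddSubmonoid ℕ) : Set ℕ :=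
  {a | a ∈ S ∧ a ≠ 0 ∧ ∀ x ∈ S, ∀ y ∈ S, x + y = a → x = 0 ∨ y = 0}

/-- The *embedding dimension*: the size of the minimal generating set. -/
noncomputable def embeddingDim (S : AddSubmonoid ℕ) : ℕ :=
  (minimalGenerators S).ncard

/-- `minimalGenerators S` generates `S` and is contained in every generating set of `S`. -/
theorem isLeast_minimalGenerators (S : AddSubmonoid ℕ) :
    IsLeast {B : Set ℕ | AddSubmonoid.closure B = S} (minimalGenerators S) := by
  constructor
  · apply le_antisymm
    · rw [AddSubmonoid.closure_le]
      exact fun a ha => ha.1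
    · intro a
      induction a using Nat.strong_induction_on with
      | _ a ih =>
        intro ha
        by_cases h : a ∈ minimalGenerators S
        · exact AddSubmonoid.subset_closure h
        by_cases h0 : a = 0
        · rw [h0]
          exact zero_mem _
        simp only [minimalGenerators, Set.mem_ofPred] at h
        push Not at h
        obtain ⟨x, hx, y, hy, hxy, hx0, hy0⟩ := h ha h0
        rw [← hxy]
        exact add_mem (ih x (by omega) hx) (ih y (by omega) hy)
  · rintro B rfl a ⟨haS, ha0, hirr⟩
    by_contra haB
    have key : ∀ x ∈ AddSubmonoid.closure B, x ≠ a := by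
      intro x hx
      induction hx using AddSubmonoid.closure_induction with
      | mem x hx =>
        rintro rfl
        exact haB hx
      | zero => exact fun h => ha0 h.symm
      | add x y hx hy ihx ihy =>
        intro h
        rcases hirr x hx y hy h with h1 | h1
        · exact ihy (by omega)
        · exact ihx (by omega)
    exact key a haS rfl

/-- For a numerical semigroup the Frobenius number is indeed the largest integer outside `S`. -/
theorem isGreatest_frobenius {S : AddSubmonoid ℕ} (hS : IsNumericalSemigroup S) :
    IsGreatest {z : ℤ | ∀ n ∈ S, (n : ℤ) ≠ z} (frobenius S) := by
  obtain ⟨N, hN⟩ := hS.bddAbove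
  have hne : {z : ℤ | ∀ n ∈ S, (n : ℤ) ≠ z}.Nonempty := ⟨-1, fun n _ => by omega⟩
  have hbd : BddAbove {z : ℤ | ∀ n ∈ S, (n : ℤ) ≠ z} := by
    refine ⟨N, fun z hz => ?_⟩
    by_contra hlt
    push Not at hlt
    have hmem : z.toNat ∈ S := by
      by_contra h
      have : z.toNat ≤ N := hN h
      omega
    exact hz _ hmem (by omega)
  exact ⟨Int.csSup_mem hne hbd, fun z hz => le_csSup hbd hz⟩

/-- The law of the random generating set `A`: each positive integer belongs to `A` with
probability `p`, independently. -/
noncomputable def generatorLaw (p : I) : Measure (Set ℕ) :=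
  ProbabilityTheory.setBernoulli {n : ℕ | 0 < n} p

/-- `E[e(S(p))]`, where `S(p) = ⟨A⟩` is generated by the random set `A`. -/
noncomputable def expectedEmbeddingDim (p : I) : ℝ :=
  ∫ A, (embeddingDim (AddSubmonoid.closure A) : ℝ) ∂(generatorLaw p)

/-- `E[g(S(p))]`. -/
noncomputable def expectedGenus (p : I) : ℝ :=
  ∫ A, (genus (AddSubmonoid.closure A) : ℝ) ∂(generatorLaw p)

/-- `E[F(S(p))]`. -/
noncomputable def expectedFrobenius (p : I) : ℝ :=
  ∫ A, (frobenius (AddSubmonoid.closure A) : ℝ) ∂(generatorLaw p)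

end RandomSemigroup

/-! Everything rests on a tail bound for the conductor. Take `M = l * m` with `m = ⌈1/p⌉` and look
for an element `a` of `A` in `(4M, 8M]`. Modulo `a`, grow a set of residues from `{0}`: stage `k`
reveals `A` only on `[a k, a (k + 1))` and adds a translate that enlarges the set by a factor of at
least 5/4. While the set fills at most half of the residues, a quarter of all translates do this
(`card_le_four_mul_card_growing`), so a stage fails with probability at most `(1 - p) ^ M`. After `K
= 16 l` successes the set exceeds half of `ZMod a` and its sumset is everything. Every residue is
then a sum of size `O(a K²)`, and adding copies of `a` yields all larger integers. A union bound
over `a` and the stages gives conductor `O(m l³)` outside an event of probability `O(l² m 2⁻ˡ)`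
(`generatorLaw_real_missesBeyond_le`).

With `L` of order `log m`, the scales `l ≥ L` contribute a convergent series bounded uniformly in
`p`, which leaves `O(m L³)` for the conductor. If all integers from `N` on are present, minimal
generators lie in `A` below `2N`, where `A` has mean size at most `2pN`; this saves the factor `1/p`
for the embedding dimension.

For the genus, `F - g` is negative only if `1 ∈ A`, with value `-1`. Two disjoint events, each of
probability `p (1 - p) ^ 4`, where `F - g ≥ 1`, compensate for this. -/

namespace RandomSemigroup

open ProbabilityTheory

/-! ### Independence under the law of the generating set -/

section Law

variable (p : I)

instance : IsProbabilityMeasure (generatorLaw p) := by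
  unfold generatorLaw; infer_instance

theorem iIndepFun_mem_generatorLaw :
    iIndepFun (fun (i : ℕ) (A : Set ℕ) => i ∈ A) (generatorLaw p) := by
  have hm : Measurable (fun (q : ℕ → Prop) => {i | q i}) := measurable_setOfPred
  have hX : ∀ i : ℕ, Measurable (fun A : Set ℕ => i ∈ A) := measurable_set_mem
  rw [iIndepFun_iff_map_fun_eq_infinitePi_map hX, generatorLaw, setBernoulli_eq_map,
    Measure.map_map (measurable_pi_lambda _ hX) hm]
  have : ((fun (A : Set ℕ) (i : ℕ) => i ∈ A) ∘ fun (q : ℕ → Prop) => {i | q i}) = id := rfl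
  rw [this, Measure.map_id]
  congr 1
  funext i
  rw [Measure.map_map (hX i) hm]
  change _ = Measure.map (fun q : ℕ → Prop => q i) _
  rw [Measure.infinitePi_map_eval]

/-- The `σ`-algebra of the events that are determined by `A ∩ T`. -/
abbrev eventsOn (T : Set ℕ) : MeasurableSpace (Set ℕ) :=
  ⨆ i ∈ T, MeasurableSpace.comap (fun A : Set ℕ => i ∈ A) ⊤

theorem eventsOn_le (T : Set ℕ) : eventsOn T ≤ (inferInstance : MeasurableSpace (Set ℕ)) :=
  iSup₂_le fun i _ => (measurable_set_mem i).comap_le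

theorem eventsOn_mono {S T : Set ℕ} (h : S ⊆ T) : eventsOn S ≤ eventsOn T :=
  biSup_mono h

theorem measurableSet_eventsOn_mem {T : Set ℕ} {i : ℕ} (hi : i ∈ T) :
    MeasurableSet[eventsOn T] {A : Set ℕ | i ∈ A} := by
  have h : MeasurableSpace.comap (fun A : Set ℕ => i ∈ A) ⊤ ≤ eventsOn T :=
    le_iSup₂ (f := fun (i : ℕ) (_ : i ∈ T) =>
      MeasurableSpace.comap (fun A : Set ℕ => i ∈ A) ⊤) i hi
  apply h
  exact ⟨{True}, trivial, by ext A; simp⟩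

theorem indep_eventsOn {S T : Set ℕ} (h : Disjoint S T) :
    Indep (eventsOn S) (eventsOn T) (generatorLaw p) :=
  indep_iSup_of_disjoint (fun i => (measurable_set_mem i).comap_le)
    (iIndepFun_mem_generatorLaw p) h

theorem generatorLaw_real_inter {S T : Set ℕ} (h : Disjoint S T) {E F : Set (Set ℕ)}
    (hE : MeasurableSet[eventsOn S] E) (hF : MeasurableSet[eventsOn T] F) :
    (generatorLaw p).real (E ∩ F) = (generatorLaw p).real E * (generatorLaw p).real F := by
  simp only [measureReal_def]
  rw [(Indep_iff _ _ _).1 (indep_eventsOn p h) E F hE hF, ENNReal.toReal_mul]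

theorem generatorLaw_real_mem {n : ℕ} (hn : 0 < n) :
    (generatorLaw p).real {A | n ∈ A} = p := by
  have hm : Measurable (fun (q : ℕ → Prop) => {i | q i}) := measurable_setOfPred
  have hE : MeasurableSet {A : Set ℕ | n ∈ A} := measurableSet_setOfPred.2 (measurable_set_mem n)
  have h1 : (fun (q : ℕ → Prop) => {i | q i}) ⁻¹' {A : Set ℕ | n ∈ A}
      = (fun q : ℕ → Prop => q n) ⁻¹' {True} := by ext q; simp
  rw [generatorLaw, setBernoulli_eq_map, measureReal_def, Measure.map_apply hm hE, h1,
    ← Measure.map_apply (measurable_pi_apply n) (by simp), Measure.infinitePi_map_eval]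
  simp [hn]

theorem measurableSet_eventsOn_notMem {T : Set ℕ} {i : ℕ} (hi : i ∈ T) :
    MeasurableSet[eventsOn T] {A : Set ℕ | i ∉ A} :=
  MeasurableSet.compl (m := eventsOn T) (measurableSet_eventsOn_mem hi)

theorem generatorLaw_real_notMem {n : ℕ} (hn : 0 < n) :
    (generatorLaw p).real {A | n ∉ A} = 1 - p := by
  have := measureReal_compl (μ := generatorLaw p)
    (measurableSet_setOfPred.2 (measurable_set_mem n) : MeasurableSet {A : Set ℕ | n ∈ A})
  rw [generatorLaw_real_mem p hn, probReal_univ] at this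
  exact this

/-- The probability that every element of `A ∩ G` fails its own test, when the tests do not
depend on `A ∩ G`. -/
theorem generatorLaw_real_forall_mem_le (G : Finset ℕ) (hG : ∀ g ∈ G, 0 < g) {T : Set ℕ}
    (hGT : Disjoint (G : Set ℕ) T) (B : ℕ → Set (Set ℕ))
    (hB : ∀ g ∈ G, MeasurableSet[eventsOn T] (B g)) {β : ℝ} (hβ0 : 0 ≤ β)
    (hβ : ∀ g ∈ G, (generatorLaw p).real (B g) ≤ β) :
    MeasurableSet[eventsOn (G ∪ T)] {A : Set ℕ | ∀ g ∈ G, g ∈ A → A ∈ B g} ∧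
    (generatorLaw p).real {A : Set ℕ | ∀ g ∈ G, g ∈ A → A ∈ B g} ≤ (1 - p : ℝ) ^ G.card + β := by
  classical
  have hp0 : (0 : ℝ) ≤ p := p.2.1
  have hp1 : (p : ℝ) ≤ 1 := p.2.2
  induction G using Finset.induction_on with
  | empty => exact ⟨by simp, by simpa using hβ0⟩
  | insert g G hg ih =>
    simp only [Finset.mem_insert, forall_eq_or_imp] at hG hB hβ
    rw [Finset.coe_insert, Set.disjoint_insert_left] at hGT
    obtain ⟨ihm, ihp⟩ := ih hG.2 hGT.2 hB.2 hβ.2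
    set R : Set (Set ℕ) := {A : Set ℕ | ∀ g ∈ G, g ∈ A → A ∈ B g} with hR
    -- Split on whether `g ∈ A`. In the second case only the failed test of `g` is kept, so `β` is
    -- averaged with weights `1 - p` and `p` and never accumulates over `G`.
    have hset : {A : Set ℕ | ∀ g' ∈ insert g G, g' ∈ A → A ∈ B g'} =
        ({A | g ∉ A} ∩ R) ∪ (({A | g ∈ A} ∩ B g) ∩ R) := by
      ext A
      simp only [hR, Finset.mem_insert, forall_eq_or_imp, Set.mem_ofPred, Set.mem_union,
        Set.mem_inter_iff]
      tauto
    have hgU : g ∈ ((insert g G : Finset ℕ) : Set ℕ) ∪ T := by simp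
    have hRU : MeasurableSet[eventsOn (((insert g G : Finset ℕ) : Set ℕ) ∪ T)] R :=
      eventsOn_mono (by gcongr; simp) _ ihm
    have hBU : MeasurableSet[eventsOn (((insert g G : Finset ℕ) : Set ℕ) ∪ T)] (B g) :=
      eventsOn_mono Set.subset_union_right _ hB.1
    refine ⟨?_, ?_⟩
    · rw [hset]
      exact ((measurableSet_eventsOn_notMem hgU).inter hRU).union
        (((measurableSet_eventsOn_mem hgU).inter hBU).inter hRU)
    · have hd1 : Disjoint {g} ((G : Set ℕ) ∪ T) := by
        simp [hg, hGT.1]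
      have hd2 : Disjoint {g} T := by simp [hGT.1]
      have e1 := generatorLaw_real_inter p hd1
        (measurableSet_eventsOn_notMem (Set.mem_singleton g)) ihm
      have e2 := generatorLaw_real_inter p hd2
        (measurableSet_eventsOn_mem (Set.mem_singleton g)) hB.1
      rw [generatorLaw_real_notMem p hG.1] at e1
      rw [generatorLaw_real_mem p hG.1] at e2
      rw [hset]
      calc _ ≤ (generatorLaw p).real ({A | g ∉ A} ∩ R)
            + (generatorLaw p).real ({A | g ∈ A} ∩ B g) :=
            (measureReal_union_le _ _).trans
              (add_le_add le_rfl (measureReal_mono Set.inter_subset_left))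
        _ ≤ (1 - p) * ((1 - p : ℝ) ^ G.card + β) + p * β := by
            rw [e1, e2]
            gcongr
            exact hβ.1
        _ = _ := by
            rw [Finset.card_insert_of_notMem hg, pow_succ]
            ring

end Law

/-! ### Growth of subsets of a finite abelian group under translation -/

section Growth

variable {G : Type*} [AddCommGroup G] [DecidableEq G]

/-- The union of `s` with its translate by `r`. -/
def addShift (r : G) (s : Finset G) : Finset G := s ∪ s.image (r + ·)

theorem card_addShift (r : G) (s : Finset G) :
    (addShift r s).card = s.card + (s.filter fun y => r + y ∉ s).card := by
  rw [addShift, Finset.union_comm, ← Finset.card_sdiff_add_card, add_comm]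
  congr 1
  rw [← Finset.card_image_of_injective (s.filter fun y => r + y ∉ s) (add_right_injective r)]
  congr 1
  ext x
  simp only [Finset.mem_sdiff, Finset.mem_image, Finset.mem_filter]
  constructor
  · rintro ⟨⟨y, hy, rfl⟩, h⟩
    exact ⟨y, ⟨hy, h⟩, rfl⟩
  · rintro ⟨y, ⟨hy, h⟩, rfl⟩
    exact ⟨⟨y, hy, rfl⟩, h⟩

variable [Fintype G]

/-- Double counting: for fixed `y` the map `r ↦ r + y` is a bijection, so exactly `sᶜ.card` values
of `r` move `y` out of `s`. -/
theorem sum_card_filter_add_notMem (s : Finset G) :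
    ∑ r : G, (s.filter fun y => r + y ∉ s).card = s.card * sᶜ.card := by
  simp only [Finset.card_filter]
  rw [Finset.sum_comm, ← smul_eq_mul, ← Finset.sum_const]
  refine Finset.sum_congr rfl fun y _ => ?_
  rw [Fintype.sum_equiv (Equiv.addRight y) (fun r => if r + y ∉ s then 1 else 0)
    (fun r => if r ∉ s then 1 else 0) (fun r => rfl), ← Finset.card_filter]
  congr 1
  ext; simp

/-- If `s` fills at most half of the group, then at least a quarter of all translates enlarge `s`
by a factor of at least `5 / 4`. -/
theorem card_le_four_mul_card_growing (s : Finset G) (hs : s.Nonempty)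
    (h : 2 * s.card ≤ Fintype.card G) :
    Fintype.card G ≤
      4 * (Finset.univ.filter fun r : G => 5 * s.card ≤ 4 * (addShift r s).card).card := by
  set good := Finset.univ.filter fun r : G => 5 * s.card ≤ 4 * (addShift r s).card with hgood
  have hsum := sum_card_filter_add_notMem s
  -- A bad translate adds fewer than `s.card / 4` new elements, a good one at most `s.card`. Summing
  -- over `r` forces many good ones.
  have hbound : ∀ r : G, 4 * (s.filter fun y => r + y ∉ s).card ≤
      s.card + (if r ∈ good then 4 * s.card else 0) := by
    intro r
    split_ifs with hr
    · have := Finset.card_filter_le s fun y => r + y ∉ s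
      omega
    · rw [hgood, Finset.mem_filter, card_addShift] at hr
      simp at hr
      omega
  have h1 := Finset.sum_le_sum fun (r : G) (_ : r ∈ Finset.univ) => hbound r
  rw [← Finset.mul_sum, hsum, Finset.sum_add_distrib, Finset.sum_const, Finset.card_univ,
    smul_eq_mul, ← Finset.sum_filter, Finset.filter_mem_eq_inter, Finset.univ_inter,
    Finset.sum_const, smul_eq_mul, Finset.card_compl] at h1
  have hpos := hs.card_pos
  have h2 : 4 * (Fintype.card G - s.card) ≤ Fintype.card G + 4 * good.card := by
    refine Nat.le_of_mul_le_mul_left ?_ hpos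
    calc _ = 4 * (s.card * (Fintype.card G - s.card)) := by ring
      _ ≤ _ := h1
      _ = _ := by ring
  omega

/-- A set that fills more than half of the group has full sumset. -/
theorem exists_add_eq_of_card_lt (s : Finset G) (h : Fintype.card G < 2 * s.card) (x : G) :
    ∃ y ∈ s, ∃ z ∈ s, y + z = x := by
  have hc : (s.image (x - ·)).card = s.card :=
    Finset.card_image_of_injective _ sub_right_injective
  -- Pigeonhole: `s` and `x - s` both fill more than half of the group.
  have : ¬ Disjoint s (s.image (x - ·)) := by
    intro hd
    have := Finset.card_le_univ (s ∪ s.image (x - ·))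
    rw [Finset.card_union_of_disjoint hd] at this
    omega
  obtain ⟨y, hy, hy'⟩ := Finset.not_disjoint_iff.1 this
  obtain ⟨z, hz, rfl⟩ := Finset.mem_image.1 hy'
  exact ⟨_, hy, z, hz, sub_add_cancel x z⟩

end Growth

/-! ### Greedy growth of residues modulo an element of `A` -/

section Stalling

variable {a : ℕ}

/-- The event that the greedy growth of the residue set `s` modulo `a` is stuck, or has not
reached more than half of all residues, after inspecting the `K` intervals
`[a j, a (j + 1))` with `k ≤ j < k + K`. -/
def stalled : ℕ → ℕ → Finset (ZMod a) → Set (Set ℕ)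
  | 0, _, s => {_A | 2 * s.card ≤ a}
  | K + 1, k, s => {A | 2 * s.card ≤ a ∧ ∀ r : ZMod a, 5 * s.card ≤ 4 * (addShift r s).card →
      a * k + r.val ∈ A → A ∈ stalled K (k + 1) (addShift r s)}

theorem stalled_eq_empty (K k : ℕ) {s : Finset (ZMod a)} (hs : a < 2 * s.card) :
    stalled K k s = ∅ := by
  cases K <;> ext A <;> simp [stalled, hs]

theorem addShift_nonempty {s : Finset (ZMod a)} (hs : s.Nonempty) (r : ZMod a) :
    (addShift r s).Nonempty := hs.mono Finset.subset_union_left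

variable [NeZero a]

/-- Each stage has at least `a / 4 ≥ M` useful integers in its own interval, and the later stages
depend only on `A` beyond that interval. Each stage therefore costs one more `(1 - p) ^ M`. The
condition on `4 ^ K` and `5 ^ K` says that `K` gains of 5/4 pass one half. -/
theorem stalled_bound (p : I) {M : ℕ} (hM : 4 * M ≤ a) (K k : ℕ) (hk : 0 < k)
    (s : Finset (ZMod a)) (hs : s.Nonempty) :
    MeasurableSet[eventsOn (Set.Ici (a * k))] (stalled K k s) ∧
    (4 ^ K * a < 5 ^ K * (2 * s.card) →
      (generatorLaw p).real (stalled K k s) ≤ K * (1 - p : ℝ) ^ M) := by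
  have hp0 : (0 : ℝ) ≤ p := p.2.1
  have hp1 : (p : ℝ) ≤ 1 := p.2.2
  have ha : 0 < a := Nat.pos_of_neZero a
  induction K generalizing k s with
  | zero =>
    refine ⟨by simp [stalled], fun h => ?_⟩
    rw [stalled_eq_empty _ _ (by simpa using h)]
    simp
  | succ K ih =>
    by_cases h2 : a < 2 * s.card
    · rw [stalled_eq_empty _ _ h2]
      refine ⟨@MeasurableSet.empty _ (eventsOn _), fun _ => ?_⟩
      rw [measureReal_empty]
      have : (0 : ℝ) ≤ 1 - p := by linarith
      positivity
    rw [not_lt] at h2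
    set good := Finset.univ.filter fun r : ZMod a => 5 * s.card ≤ 4 * (addShift r s).card
      with hgood
    have hinj : Function.Injective fun r : ZMod a => a * k + r.val :=
      fun r r' h => ZMod.val_injective a (by simpa using h)
    set D := good.image fun r : ZMod a => a * k + r.val with hD
    have hcast : ∀ r : ZMod a, ((a * k + r.val : ℕ) : ZMod a) = r := by
      intro r; simp
    set B : ℕ → Set (Set ℕ) := fun n => stalled K (k + 1) (addShift (n : ZMod a) s) with hB
    have hset : stalled (K + 1) k s = {A | ∀ n ∈ D, n ∈ A → A ∈ B n} := by
      ext A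
      simp only [stalled, Set.mem_ofPred, h2, true_and, hD, Finset.mem_image, hgood,
        Finset.mem_filter, Finset.mem_univ, hB]
      constructor
      · rintro h _ ⟨r, hr, rfl⟩ hA
        rw [hcast]
        exact h r hr hA
      · intro h r hr hA
        have := h _ ⟨r, hr, rfl⟩ hA
        rwa [hcast] at this
    have hcardD : M ≤ D.card := by
      rw [hD, Finset.card_image_of_injective _ hinj]
      have : a ≤ 4 * good.card := by
        convert card_le_four_mul_card_growing s hs (by rwa [ZMod.card])
        rw [ZMod.card]
      omega
    have hDpos : ∀ n ∈ D, 0 < n := by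
      intro n hn
      obtain ⟨r, -, rfl⟩ := Finset.mem_image.1 hn
      positivity
    have hDlt : Disjoint (D : Set ℕ) (Set.Ici (a * (k + 1))) := by
      rw [Set.disjoint_left]
      intro n hn hn'
      obtain ⟨r, -, rfl⟩ := Finset.mem_image.1 (Finset.mem_coe.1 hn)
      have := ZMod.val_lt r
      rw [Set.mem_Ici, mul_add] at hn'
      omega
    have hDU : (D : Set ℕ) ∪ Set.Ici (a * (k + 1)) ⊆ Set.Ici (a * k) := by
      apply Set.union_subset
      · intro n hn
        obtain ⟨r, -, rfl⟩ := Finset.mem_image.1 (Finset.mem_coe.1 hn)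
        simp
      · exact Set.Ici_subset_Ici.2 (by gcongr; simp)
    have hBm : ∀ n ∈ D, MeasurableSet[eventsOn (Set.Ici (a * (k + 1)))] (B n) := fun n _ =>
      (ih (k + 1) (by omega) _ (addShift_nonempty hs _)).1
    rw [hset]
    refine ⟨?_, fun h => ?_⟩
    · exact eventsOn_mono hDU _ (generatorLaw_real_forall_mem_le p D hDpos hDlt B hBm
        zero_le_one (fun _ _ => measureReal_le_one)).1
    · have h1p : (0 : ℝ) ≤ 1 - p := by linarith
      refine (generatorLaw_real_forall_mem_le p D hDpos hDlt B hBm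
        (β := K * (1 - p : ℝ) ^ M) (by positivity) fun n hn => ?_).2.trans ?_
      -- The gain of 5/4 from a useful `r` pays for the stage just spent.
      · refine (ih (k + 1) (by omega) _ (addShift_nonempty hs _)).2 ?_
        obtain ⟨r, hr, rfl⟩ := Finset.mem_image.1 hn
        rw [hcast]
        rw [hgood, Finset.mem_filter] at hr
        have h4 : 4 * (4 ^ K * a) < 4 * (5 ^ K * (2 * (addShift r s).card)) := by
          calc _ = 4 ^ (K + 1) * a := by ring
            _ < _ := h
            _ = 5 ^ K * 2 * (5 * s.card) := by ring
            _ ≤ 5 ^ K * 2 * (4 * (addShift r s).card) := Nat.mul_le_mul_left _ hr.2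
            _ = _ := by ring
        omega
      · have : (1 - p : ℝ) ^ D.card ≤ (1 - p : ℝ) ^ M :=
          pow_le_pow_of_le_one h1p (by linarith) hcardD
        push_cast
        linarith

/-- A residue reached from `s` differs from one in `s` by a sum of at most one element of `A` per
stage, each below `a * (k + K)`. -/
theorem exists_residues_of_notMem_stalled {A : Set ℕ} (K k : ℕ) (s : Finset (ZMod a))
    (h : A ∉ stalled K k s) :
    ∃ t : Finset (ZMod a), a < 2 * t.card ∧ ∀ x ∈ t, ∃ y ∈ s, ∃ n ∈ AddSubmonoid.closure A,
      n ≤ K * (a * (k + K)) ∧ x = y + n := by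
  induction K generalizing k s with
  | zero =>
    refine ⟨s, by simpa [stalled] using h, fun x hx => ⟨x, hx, 0, zero_mem _, by simp⟩⟩
  | succ K ih =>
    by_cases h2 : a < 2 * s.card
    · exact ⟨s, h2, fun x hx => ⟨x, hx, 0, zero_mem _, by simp⟩⟩
    simp only [stalled, Set.mem_ofPred, not_and, not_forall] at h
    obtain ⟨r, -, hrA, hr⟩ := h (by omega)
    obtain ⟨t, ht, hx⟩ := ih (k + 1) _ hr
    refine ⟨t, ht, fun x hxt => ?_⟩
    obtain ⟨y, hy, n, hn, hle, rfl⟩ := hx x hxt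
    have hle' : K * (a * (k + 1 + K)) + (a * k + a) ≤ (K + 1) * (a * (k + (K + 1))) := by
      nlinarith [Nat.zero_le (a * K)]
    rcases Finset.mem_union.1 hy with hy | hy
    · exact ⟨y, hy, n, hn, by omega, rfl⟩
    · obtain ⟨y', hy', rfl⟩ := Finset.mem_image.1 hy
      refine ⟨y', hy', a * k + r.val + n, add_mem (AddSubmonoid.subset_closure hrA) hn, ?_, ?_⟩
      · have := ZMod.val_lt r
        omega
      · simp only [Nat.cast_add, Nat.cast_mul, CharP.cast_eq_zero, zero_mul, zero_add,
          ZMod.natCast_val, ZMod.cast_id', id_eq]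
        ring

/-- If `a ∈ A` and the growth of `{0}` modulo `a` does not stall, then all large integers are
sums of elements of `A`. -/
theorem mem_closure_of_notMem_stalled {A : Set ℕ} {K : ℕ} (haA : a ∈ A)
    (h : A ∉ stalled K 1 {(0 : ZMod a)}) {n : ℕ} (hn : 2 * (K * (a * (1 + K))) ≤ n) :
    n ∈ AddSubmonoid.closure A := by
  obtain ⟨t, ht, hx⟩ := exists_residues_of_notMem_stalled K 1 _ h
  obtain ⟨y, hy, z, hz, hyz⟩ := exists_add_eq_of_card_lt t (by rwa [ZMod.card]) (n : ZMod a)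
  obtain ⟨y', hy', u, hu, hule, rfl⟩ := hx y hy
  obtain ⟨z', hz', v, hv, hvle, rfl⟩ := hx z hz
  rw [Finset.mem_singleton] at hy' hz'
  subst hy' hz'
  have hle : u + v ≤ n := by omega
  have hdvd : a ∣ n - (u + v) := by
    rw [← ZMod.natCast_eq_zero_iff, Nat.cast_sub hle, ← hyz]
    push_cast
    ring
  obtain ⟨c, hc⟩ := hdvd
  have : n = u + v + c • a := by
    rw [smul_eq_mul, mul_comm]; omega
  rw [this]
  exact add_mem (add_mem hu hv) (nsmul_mem (AddSubmonoid.subset_closure haA) c)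

end Stalling

/-! ### Tail bound from a union over the moduli -/

section Tail

/-- Either `A` misses `(4M, 8M]`, or growth stalls for one of the `4M` moduli in it. The lower end
provides `M` useful integers per stage; the upper end makes `K` and `N` suffice for all moduli.
Taking the union over all moduli avoids conditioning on which one lies in `A`. -/
theorem generatorLaw_real_exists_notMem_le (p : I) {M K N : ℕ} (hM : 0 < M)
    (hK : 4 ^ K * (8 * M) < 5 ^ K * 2) (hN : 2 * (K * (8 * M * (1 + K))) ≤ N) :
    (generatorLaw p).real {A | ∃ n, N ≤ n ∧ n ∉ AddSubmonoid.closure A} ≤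
      (1 + 4 * M * K) * (1 - p : ℝ) ^ M := by
  have hp0 : (0 : ℝ) ≤ p := p.2.1
  have hp1 : (p : ℝ) ≤ 1 := p.2.2
  set D := Finset.Ioc (4 * M) (8 * M) with hD
  have hDcard : D.card = 4 * M := by rw [hD, Nat.card_Ioc]; omega
  have hsub : {A : Set ℕ | ∃ n, N ≤ n ∧ n ∉ AddSubmonoid.closure A} ⊆
      {A | ∀ g ∈ D, g ∈ A → A ∈ (∅ : Set (Set ℕ))} ∪
        ⋃ g ∈ D, stalled K 1 {(0 : ZMod g)} := by
    rintro A ⟨n, hNn, hn⟩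
    by_contra hA
    simp only [Set.mem_union, Set.mem_ofPred, Set.mem_iUnion, not_or, not_forall,
      not_exists] at hA
    obtain ⟨⟨g, hg, hgA, -⟩, h2⟩ := hA
    have hg' := Finset.mem_Ioc.1 hg
    have : NeZero g := ⟨by omega⟩
    refine hn (mem_closure_of_notMem_stalled hgA (h2 g hg) (le_trans ?_ (hN.trans hNn)))
    gcongr
    exact hg'.2
  have h1 : (generatorLaw p).real {A | ∀ g ∈ D, g ∈ A → A ∈ (∅ : Set (Set ℕ))} ≤
      (1 - p : ℝ) ^ M := by
    refine (generatorLaw_real_forall_mem_le p D (fun g hg => ?_) (Set.disjoint_empty _)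
      (fun _ => ∅) (fun _ _ => @MeasurableSet.empty _ (eventsOn _)) le_rfl (by simp)).2.trans ?_
    · have := (Finset.mem_Ioc.1 hg).1; omega
    · rw [add_zero]
      exact pow_le_pow_of_le_one (by linarith) (by linarith) (by omega)
  have h2 : (generatorLaw p).real (⋃ g ∈ D, stalled K 1 {(0 : ZMod g)}) ≤
      4 * M * (K * (1 - p : ℝ) ^ M) := by
    refine (measureReal_biUnion_finset_le _ _).trans ?_
    refine (Finset.sum_le_card_nsmul _ _ (K * (1 - p : ℝ) ^ M) fun g hg => ?_).trans ?_
    · have hg' := Finset.mem_Ioc.1 hg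
      have : NeZero g := ⟨by omega⟩
      refine (stalled_bound p (by omega) K 1 one_pos _ (Finset.singleton_nonempty _)).2 ?_
      rw [Finset.card_singleton, mul_one]
      exact lt_of_le_of_lt (Nat.mul_le_mul_left _ hg'.2) hK
    · rw [hDcard, nsmul_eq_mul]
      push_cast
      exact le_rfl
  calc _ ≤ _ := measureReal_mono hsub
    _ ≤ _ := measureReal_union_le _ _
    _ ≤ (1 - p : ℝ) ^ M + 4 * M * (K * (1 - p : ℝ) ^ M) := add_le_add h1 h2
    _ = _ := by ring

end Tail

/-! ### The conductor and its relation to the other invariants -/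

section Conductor

/-- The number of `n` beyond which some integer is missing from `S`; for a numerical semigroup
it is the least `N` such that `S` contains all `n ≥ N`. -/
noncomputable def conductor (S : AddSubmonoid ℕ) : ℕ :=
  {n : ℕ | ∃ m, n ≤ m ∧ m ∉ S}.ncard

variable {S : AddSubmonoid ℕ}

theorem conductor_le {N : ℕ} (h : ∀ n, N ≤ n → n ∈ S) : conductor S ≤ N := by
  have : {n : ℕ | ∃ m, n ≤ m ∧ m ∉ S} ⊆ Set.Iio N := by
    rintro n ⟨m, hnm, hm⟩
    by_contra hn
    exact hm (h m (le_trans (by simpa using hn) hnm))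
  simpa [conductor] using Set.ncard_le_ncard this (Set.finite_Iio N)

theorem isNumericalSemigroup_iff : IsNumericalSemigroup S ↔ ∃ N, ∀ n, N ≤ n → n ∈ S := by
  constructor
  · intro h
    obtain ⟨N, hN⟩ := Set.Finite.bddAbove h
    refine ⟨N + 1, fun n hn => ?_⟩
    by_contra hnS
    have := hN hnS
    omega
  · rintro ⟨N, hN⟩
    refine (Set.finite_Iio N).subset fun n hn => ?_
    by_contra h
    exact hn (hN n (by simpa using h))

theorem lt_conductor_iff (hS : IsNumericalSemigroup S) {n : ℕ} :
    n < conductor S ↔ ∃ m, n ≤ m ∧ m ∉ S := by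
  classical
  have hex := isNumericalSemigroup_iff.1 hS
  have hset : {n : ℕ | ∃ m, n ≤ m ∧ m ∉ S} = Set.Iio (Nat.find hex) := by
    ext n
    rw [Set.mem_Iio, Nat.lt_find_iff]
    simp only [Set.mem_ofPred, not_forall, exists_prop]
    exact ⟨fun ⟨m, hm, h⟩ k hk => ⟨m, hk.trans hm, h⟩, fun h => h n le_rfl⟩
  have hc : conductor S = Nat.find hex := by
    rw [conductor, hset]; simp
  rw [hc, ← Set.mem_Iio, ← hset, Set.mem_ofPred]

theorem mem_of_conductor_le (hS : IsNumericalSemigroup S) {n : ℕ} (h : conductor S ≤ n) :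
    n ∈ S := by
  by_contra hn
  exact absurd ((lt_conductor_iff hS).2 ⟨n, le_rfl, hn⟩) (by omega)

theorem frobenius_eq_conductor_sub_one (hS : IsNumericalSemigroup S) :
    frobenius S = (conductor S : ℤ) - 1 := by
  refine (isGreatest_frobenius hS).unique ⟨fun n hn h => ?_, fun z hz => ?_⟩
  · obtain ⟨m, hnm, hm⟩ := (lt_conductor_iff hS (n := n)).1 (by omega)
    have hmc := (lt_conductor_iff hS).2 ⟨m, le_rfl, hm⟩
    have : m = n := by omega
    exact hm (this ▸ hn)
  · by_contra hlt
    exact hz z.toNat (mem_of_conductor_le hS (by omega)) (by omega)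

theorem gaps_subset_Iio (hS : IsNumericalSemigroup S) : gaps S ⊆ Set.Iio (conductor S) :=
  fun n hn => (lt_conductor_iff hS).2 ⟨n, le_rfl, hn⟩

theorem genus_le_conductor (hS : IsNumericalSemigroup S) : genus S ≤ conductor S := by
  simpa [genus] using Set.ncard_le_ncard (gaps_subset_Iio hS) (Set.finite_Iio _)

/-- An element `a ≥ 2N` splits as `N + (a - N)` with both parts nonzero and in the semigroup, so it
is not a minimal generator. -/
theorem embeddingDim_closure_le {A : Set ℕ} {N : ℕ} (hN : 0 < N)
    (h : ∀ n, N ≤ n → n ∈ AddSubmonoid.closure A) :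
    embeddingDim (AddSubmonoid.closure A) ≤ (A ∩ Set.Iio (2 * N)).ncard := by
  refine Set.ncard_le_ncard (fun a ha => ⟨(isLeast_minimalGenerators _).2 rfl ha, ?_⟩)
    ((Set.finite_Iio _).inter_of_right _)
  by_contra h2
  rw [Set.mem_Iio, not_lt] at h2
  rcases ha.2.2 N (h N le_rfl) (a - N) (h _ (by omega)) (by omega) with h3 | h3 <;> omega

end Conductor

/-! ### Measurability of the invariants -/

section Measurability

/-- There are countably many lists, so this form exhibits membership as a countable union of
measurable events. -/
theorem mem_closure_iff_exists_list {A : Set ℕ} {n : ℕ} :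
    n ∈ AddSubmonoid.closure A ↔ ∃ l : List ℕ, l.sum = n ∧ ∀ x ∈ l, x ∈ A := by
  constructor
  · intro h
    obtain ⟨l, hl, hs⟩ := AddSubmonoid.exists_list_of_mem_closure h
    exact ⟨l, hs, hl⟩
  · rintro ⟨l, rfl, hl⟩
    exact list_sum_mem fun x hx => AddSubmonoid.subset_closure (hl x hx)

theorem measurable_mem_closure (n : ℕ) :
    Measurable fun A : Set ℕ => n ∈ AddSubmonoid.closure A := by
  have := measurable_set_mem (α := ℕ)
  simp only [mem_closure_iff_exists_list]
  fun_prop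

theorem measurable_genus_closure :
    Measurable fun A : Set ℕ => genus (AddSubmonoid.closure A) := by
  refine measurable_ncard.comp (measurable_set_iff.2 fun n => ?_)
  exact (measurable_mem_closure n).not

theorem measurable_conductor_closure :
    Measurable fun A : Set ℕ => conductor (AddSubmonoid.closure A) := by
  refine measurable_ncard.comp (measurable_set_iff.2 fun n => ?_)
  have := measurable_mem_closure
  simp only [Set.mem_ofPred]
  fun_prop

theorem measurable_embeddingDim_closure :
    Measurable fun A : Set ℕ => embeddingDim (AddSubmonoid.closure A) := by
  refine measurable_ncard.comp (measurable_set_iff.2 fun n => ?_)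
  have := measurable_mem_closure
  simp only [minimalGenerators, Set.mem_ofPred]
  fun_prop

end Measurability

open scoped ENNReal

/-! ### Summing the tail to bound expectations -/

section TailSum

/-- The event that some integer `n ≥ N` is not a sum of elements of `A`. -/
def missesBeyond (N : ℕ) : Set (Set ℕ) := {A | ∃ n, N ≤ n ∧ n ∉ AddSubmonoid.closure A}

theorem measurableSet_missesBeyond (N : ℕ) : MeasurableSet (missesBeyond N) := by
  have := measurable_mem_closure
  refine measurableSet_setOfPred.2 ?_
  fun_prop

theorem mem_closure_of_notMem_missesBeyond {N : ℕ} {A : Set ℕ} (h : A ∉ missesBeyond N) (n : ℕ)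
    (hn : N ≤ n) : n ∈ AddSubmonoid.closure A := by
  by_contra h'
  exact h ⟨n, hn, h'⟩

/-- A bound for the conductor that is violated with probability about `2⁻ˡ`, if `m ≥ 1 / p`. -/
def conductorBound (m l : ℕ) : ℕ := 4352 * m * l ^ 3

theorem one_sub_pow_le_half {p : ℝ} (hp1 : p ≤ 1) {m : ℕ} (hm : 1 ≤ p * m) :
    (1 - p) ^ m ≤ 1 / 2 := by
  calc (1 - p) ^ m ≤ (Real.exp (-p)) ^ m := by
        have : 0 ≤ 1 - p := by linarith
        gcongr
        linarith [Real.add_one_le_exp (-p)]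
    _ = Real.exp (-(p * m)) := by rw [← Real.exp_nat_mul]; ring_nf
    _ ≤ Real.exp (-1) := by gcongr
    _ = (Real.exp 1)⁻¹ := Real.exp_neg 1
    _ ≤ 2⁻¹ := by
        gcongr
        linarith [Real.add_one_le_exp (1 : ℝ)]
    _ = 1 / 2 := by norm_num

theorem generatorLaw_real_missesBeyond_le (p : I) {m l : ℕ} (hm : 1 ≤ (p : ℝ) * m) (hl : 0 < l)
    (hml : (m : ℝ) ^ 2 ≤ (4 / 3) ^ l) :
    (generatorLaw p).real (missesBeyond (conductorBound m l)) ≤ 65 * l ^ 2 * m * (1 / 2) ^ l := by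
  have hp1 : (p : ℝ) ≤ 1 := p.2.2
  have hm0 : 0 < m := by
    rcases Nat.eq_zero_or_pos m with rfl | h
    · norm_num at hm
    · exact h
  have hm1 : (1 : ℝ) ≤ m := by exact_mod_cast hm0
  have hl1 : (1 : ℝ) ≤ l := by exact_mod_cast hl
  have hm2 : m ≤ 2 ^ l := by
    have : (m : ℝ) ≤ 2 ^ l := by
      calc (m : ℝ) ≤ m ^ 2 := by nlinarith
        _ ≤ (4 / 3) ^ l := hml
        _ ≤ 2 ^ l := by gcongr; norm_num
    exact_mod_cast this
  -- The number 16 is chosen because `(5/4) ^ 16 > 32`, and `32 ^ l` exceeds `4 * l * m` as `m ≤ 2 ^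
  -- l`.
  have hK : 4 ^ (16 * l) * (8 * (l * m)) < 5 ^ (16 * l) * 2 := by
    have h1 : 4 * (l * m) < 32 ^ l := by
      calc 4 * (l * m) ≤ 4 ^ l * (l * 2 ^ l) := by
            gcongr
            exact Nat.le_self_pow hl.ne' 4
        _ < 4 ^ l * (2 ^ l * 2 ^ l) := by
            gcongr
            exact Nat.lt_two_pow_self
        _ = 16 ^ l := by norm_num [← mul_pow]
        _ ≤ 32 ^ l := by gcongr; norm_num
    calc 4 ^ (16 * l) * (8 * (l * m)) = 4 ^ (16 * l) * (4 * (l * m)) * 2 := by ring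
      _ < 4 ^ (16 * l) * 32 ^ l * 2 := by gcongr
      _ = (4 ^ 16 * 32) ^ l * 2 := by rw [pow_mul, ← mul_pow]
      _ ≤ (5 ^ 16) ^ l * 2 := by gcongr; norm_num
      _ = _ := by rw [← pow_mul]
  have hN : 2 * (16 * l * (8 * (l * m) * (1 + 16 * l))) ≤ conductorBound m l := by
    calc 2 * (16 * l * (8 * (l * m) * (1 + 16 * l)))
        ≤ 2 * (16 * l * (8 * (l * m) * (l + 16 * l))) := by gcongr; exact hl
      _ = _ := by rw [conductorBound]; ring
  refine (generatorLaw_real_exists_notMem_le p (Nat.mul_pos hl hm0) hK hN).trans ?_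
  have hpow : (1 - p : ℝ) ^ (l * m) ≤ (1 / 2) ^ l := by
    rw [mul_comm, pow_mul]
    have : (0 : ℝ) ≤ 1 - p := by linarith
    gcongr
    exact one_sub_pow_le_half hp1 hm
  have h64 : 1 + 4 * ((l * m : ℕ) : ℝ) * ((16 * l : ℕ) : ℝ) ≤ 65 * l ^ 2 * m := by
    push_cast
    have : (1 : ℝ) ≤ l ^ 2 * m := one_le_mul_of_one_le_of_one_le (one_le_pow₀ hl1) hm1
    nlinarith
  gcongr

/-- The terms of the convergent series that bounds the contribution of untypical outcomes. -/
noncomputable def tailTerm (l : ℕ) : ℝ := 4526080 * (l ^ 5 * (2 / 3) ^ l)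

theorem tailTerm_nonneg (l : ℕ) : 0 ≤ tailTerm l := by
  unfold tailTerm; positivity

theorem summable_tailTerm : Summable tailTerm := by
  refine Summable.mul_left _ (summable_pow_mul_geometric_of_norm_lt_one 5 ?_)
  norm_num

/-- Bound and probability each carry a factor `m`; the hypothesis trades `m ^ 2` for `(4/3) ^ l`,
leaving the ratio `1/2 * 4/3 = 2/3`, free of `p`. -/
theorem two_mul_conductorBound_mul_le (p : I) {m l : ℕ} (hm : 1 ≤ (p : ℝ) * m) (hl : 0 < l)
    (hml : (m : ℝ) ^ 2 ≤ (4 / 3) ^ l) :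
    ((2 * conductorBound m (l + 1) : ℕ) : ℝ) *
      (generatorLaw p).real (missesBeyond (conductorBound m l)) ≤ tailTerm l := by
  have hl1 : (1 : ℝ) ≤ l := by exact_mod_cast hl
  calc _ ≤ ((2 * conductorBound m (l + 1) : ℕ) : ℝ) * (65 * l ^ 2 * m * (1 / 2) ^ l) := by
        gcongr
        exact generatorLaw_real_missesBeyond_le p hm hl hml
    _ = 8704 * m * ((l : ℝ) + 1) ^ 3 * (65 * l ^ 2 * m * (1 / 2) ^ l) := by
        rw [conductorBound]; push_cast; ring
    _ ≤ 8704 * m * ((l : ℝ) + l) ^ 3 * (65 * l ^ 2 * m * (1 / 2) ^ l) := by gcongr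
    _ = 4526080 * l ^ 5 * (1 / 2) ^ l * (m : ℝ) ^ 2 := by ring
    _ ≤ 4526080 * l ^ 5 * (1 / 2) ^ l * (4 / 3) ^ l := by gcongr
    _ = 4526080 * (l ^ 5 * ((1 / 2) ^ l * (4 / 3) ^ l)) := by ring
    _ = tailTerm l := by
        rw [← mul_pow, tailTerm]; norm_num

variable {p : I} {m L : ℕ}

/-- The exceptional set lies in every `missesBeyond` event, and their probabilities tend to zero. -/
theorem ae_isNumericalSemigroup (hm : 1 ≤ (p : ℝ) * m) (hL : 0 < L)
    (hmL : ∀ l, L ≤ l → (m : ℝ) ^ 2 ≤ (4 / 3) ^ l) :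
    ∀ᵐ A ∂(generatorLaw p), IsNumericalSemigroup (AddSubmonoid.closure A) := by
  set Z := {A : Set ℕ | ¬ IsNumericalSemigroup (AddSubmonoid.closure A)} with hZ
  have hm0 : 0 < m := by
    rcases Nat.eq_zero_or_pos m with rfl | h
    · norm_num at hm
    · exact h
  have hbound : ∀ j, (generatorLaw p).real Z ≤ tailTerm (j + L) := by
    intro j
    have hsub : Z ⊆ missesBeyond (conductorBound m (j + L)) := by
      intro A hA
      by_contra h
      exact hA (isNumericalSemigroup_iff.2 ⟨_, mem_closure_of_notMem_missesBeyond h⟩)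
    have hone : (1 : ℝ) ≤ (2 * conductorBound m (j + L + 1) : ℕ) := by
      have : 0 < 2 * conductorBound m (j + L + 1) := by unfold conductorBound; positivity
      exact_mod_cast this
    calc _ ≤ (generatorLaw p).real (missesBeyond (conductorBound m (j + L))) :=
          measureReal_mono hsub
      _ ≤ ((2 * conductorBound m (j + L + 1) : ℕ) : ℝ) * _ :=
          le_mul_of_one_le_left measureReal_nonneg hone
      _ ≤ _ := two_mul_conductorBound_mul_le p hm (by omega) (hmL _ (by omega))
  have hlim : Tendsto (fun j => tailTerm (j + L)) atTop (𝓝 0) :=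
    (tendsto_add_atTop_iff_nat L).2 summable_tailTerm.tendsto_atTop_zero
  have h0 := measureReal_nonneg.antisymm' (ge_of_tendsto' hlim hbound)
  rwa [measureReal_eq_zero_iff] at h0

/-- Consider the first scale at which `A` succeeds. If it is `L`, then `g` suffices; if it is `L + j
+ 1`, then `A` fails at `L + j` and the `j`-th indicator pays. -/
theorem le_add_tsum_of_forall {f : Set ℕ → ℕ} {g : Set ℕ → ℝ≥0∞}
    (hg : ∀ A, A ∉ missesBeyond (conductorBound m L) → (f A : ℝ≥0∞) ≤ g A)
    (hf : ∀ A l, 0 < l → A ∉ missesBeyond (conductorBound m l) → f A ≤ 2 * conductorBound m l)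
    {A : Set ℕ} (hA : ∃ j, A ∉ missesBeyond (conductorBound m (L + j))) :
    (f A : ℝ≥0∞) ≤ g A + ∑' j, (missesBeyond (conductorBound m (L + j))).indicator
      (fun _ => ((2 * conductorBound m (L + j + 1) : ℕ) : ℝ≥0∞)) A := by
  classical
  rcases Nat.eq_zero_or_pos (Nat.find hA) with h0 | hpos
  · exact (hg A (by simpa [h0] using Nat.find_spec hA)).trans le_self_add
  · obtain ⟨j, hj⟩ : ∃ j, Nat.find hA = j + 1 := ⟨_, (Nat.succ_pred_eq_of_pos hpos).symm⟩
    have h1 : A ∉ missesBeyond (conductorBound m (L + j + 1)) := by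
      have := Nat.find_spec hA
      rwa [hj] at this
    have h2 : A ∈ missesBeyond (conductorBound m (L + j)) := by
      have := Nat.find_min hA (m := j) (by omega)
      rwa [not_not] at this
    refine le_add_of_nonneg_of_le zero_le (le_trans ?_ (ENNReal.le_tsum j))
    rw [Set.indicator_of_mem h2]
    exact_mod_cast hf A _ (by omega) h1

/-- The main term `g` may be random: a constant serves the conductor, but the embedding dimension
needs the count of `A` below a bound, whose mean gains a factor `p`. -/
theorem lintegral_natCast_le {f : Set ℕ → ℕ} {g : Set ℕ → ℝ≥0∞} (hgm : Measurable g)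
    (hm : 1 ≤ (p : ℝ) * m) (hL : 0 < L) (hmL : ∀ l, L ≤ l → (m : ℝ) ^ 2 ≤ (4 / 3) ^ l)
    (hg : ∀ A, A ∉ missesBeyond (conductorBound m L) → (f A : ℝ≥0∞) ≤ g A)
    (hf : ∀ A l, 0 < l → A ∉ missesBeyond (conductorBound m l) →
      f A ≤ 2 * conductorBound m l) :
    ∫⁻ A, (f A : ℝ≥0∞) ∂(generatorLaw p) ≤
      ∫⁻ A, g A ∂(generatorLaw p) + ENNReal.ofReal (∑' l, tailTerm l) := by
  have hae : ∀ᵐ A ∂(generatorLaw p), (f A : ℝ≥0∞) ≤ g A + ∑' j,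
      (missesBeyond (conductorBound m (L + j))).indicator
      (fun _ => ((2 * conductorBound m (L + j + 1) : ℕ) : ℝ≥0∞)) A := by
    filter_upwards [ae_isNumericalSemigroup hm hL hmL] with A hA
    refine le_add_tsum_of_forall hg hf ?_
    obtain ⟨N, hN⟩ := isNumericalSemigroup_iff.1 hA
    refine ⟨N, fun ⟨n, hn, hnA⟩ => hnA (hN n (le_trans ?_ hn))⟩
    have hm0 : 0 < m := by
      rcases Nat.eq_zero_or_pos m with rfl | h
      · norm_num at hm
      · exact h
    calc N ≤ L + N := by omega
      _ ≤ (L + N) ^ 3 := Nat.le_self_pow (by norm_num) _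
      _ ≤ conductorBound m (L + N) := Nat.le_mul_of_pos_left _ (by positivity)
  refine (lintegral_mono_ae hae).trans ?_
  rw [lintegral_add_left hgm, lintegral_tsum fun j =>
    (measurable_const.indicator (measurableSet_missesBeyond _)).aemeasurable]
  gcongr
  rw [ENNReal.ofReal_tsum_of_nonneg tailTerm_nonneg summable_tailTerm]
  calc _ ≤ ∑' j, ENNReal.ofReal (tailTerm (L + j)) := by
        refine ENNReal.tsum_le_tsum fun j => ?_
        rw [lintegral_indicator_const (measurableSet_missesBeyond _),
          ← ofReal_measureReal (μ := generatorLaw p), ← ENNReal.ofReal_natCast,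
          ← ENNReal.ofReal_mul (by positivity)]
        exact ENNReal.ofReal_le_ofReal
          (two_mul_conductorBound_mul_le p hm (by omega) (hmL _ (by omega)))
    _ ≤ _ := ENNReal.tsum_comp_le_tsum_of_injective (add_right_injective L)
        fun l => ENNReal.ofReal (tailTerm l)

theorem integrable_natCast_of_lintegral_le {Ω : Type*} [MeasurableSpace Ω] {μ : Measure Ω}
    {f : Ω → ℕ} (hf : Measurable f) {b : ℝ} (hb : 0 ≤ b)
    (h : ∫⁻ ω, (f ω : ℝ≥0∞) ∂μ ≤ ENNReal.ofReal b) :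
    Integrable (fun ω => (f ω : ℝ)) μ ∧ ∫ ω, (f ω : ℝ) ∂μ ≤ b := by
  have hm : Measurable fun ω => (f ω : ℝ) := measurable_from_nat.comp hf
  have heq : ∫⁻ ω, ENNReal.ofReal (f ω : ℝ) ∂μ = ∫⁻ ω, (f ω : ℝ≥0∞) ∂μ := by simp
  have hnn : 0 ≤ᵐ[μ] fun ω => (f ω : ℝ) := Eventually.of_forall fun ω => Nat.cast_nonneg _
  constructor
  · refine ⟨hm.aestronglyMeasurable, ?_⟩
    rw [hasFiniteIntegral_iff_ofReal hnn, heq]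
    exact h.trans_lt ENNReal.ofReal_lt_top
  · rw [integral_eq_lintegral_of_nonneg_ae hnn hm.aestronglyMeasurable, heq]
    exact ENNReal.toReal_le_of_le_ofReal hb h

theorem lintegral_ncard_inter_Iio_le (p : I) (n : ℕ) :
    Measurable (fun A : Set ℕ => ((A ∩ Set.Iio n).ncard : ℝ≥0∞)) ∧
    ∫⁻ A, ((A ∩ Set.Iio n).ncard : ℝ≥0∞) ∂(generatorLaw p) ≤ ENNReal.ofReal (p * n) := by
  classical
  have hm : ∀ i : ℕ, MeasurableSet {A : Set ℕ | i ∈ A} := fun i =>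
    measurableSet_setOfPred.2 (measurable_set_mem i)
  have heq : (fun A : Set ℕ => ((A ∩ Set.Iio n).ncard : ℝ≥0∞)) =
      fun A => ∑ i ∈ Finset.range n, {A : Set ℕ | i ∈ A}.indicator (fun _ => 1) A := by
    funext A
    have : A ∩ Set.Iio n = ((Finset.range n).filter (· ∈ A) : Finset ℕ) := by
      ext i; simp [and_comm]
    rw [this, Set.ncard_coe_finset, Finset.card_filter]
    push_cast
    simp [Set.indicator_apply]
  have hmi : ∀ i : ℕ, Measurable ({A : Set ℕ | i ∈ A}.indicator fun _ => (1 : ℝ≥0∞)) := fun i =>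
    measurable_const.indicator (hm i)
  rw [heq]
  refine ⟨Finset.measurable_fun_sum _ fun i _ => hmi i, ?_⟩
  rw [lintegral_finsetSum _ fun i _ => hmi i]
  calc _ ≤ ∑ i ∈ Finset.range n, ENNReal.ofReal p := by
        refine Finset.sum_le_sum fun i _ => ?_
        rw [lintegral_indicator_const (hm i), one_mul, ← ofReal_measureReal]
        apply ENNReal.ofReal_le_ofReal
        -- The index `0` is almost surely absent from `A`, so its probability is not `p`.
        rcases Nat.eq_zero_or_pos i with rfl | hi
        · have := ProbabilityTheory.setBernoulli_ae_subset (u := {n : ℕ | 0 < n}) (p := p)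
          have h0 : (generatorLaw p) {A : Set ℕ | 0 ∈ A} = 0 := by
            refine measure_mono_null (fun A hA => ?_) this
            exact fun h => lt_irrefl 0 (h hA)
          rw [measureReal_def, h0]
          exact p.2.1
        · exact (generatorLaw_real_mem p hi).le
    _ = _ := by
        rw [Finset.sum_const, Finset.card_range, nsmul_eq_mul, mul_comm,
          ENNReal.ofReal_mul p.2.1, ENNReal.ofReal_natCast]

theorem integral_conductor_le (hm : 1 ≤ (p : ℝ) * m) (hL : 0 < L)
    (hmL : ∀ l, L ≤ l → (m : ℝ) ^ 2 ≤ (4 / 3) ^ l) :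
    Integrable (fun A => (conductor (AddSubmonoid.closure A) : ℝ)) (generatorLaw p) ∧
    ∫ A, (conductor (AddSubmonoid.closure A) : ℝ) ∂(generatorLaw p) ≤
      conductorBound m L + ∑' l, tailTerm l := by
  have hD : 0 ≤ ∑' l, tailTerm l := tsum_nonneg tailTerm_nonneg
  refine integrable_natCast_of_lintegral_le measurable_conductor_closure (by positivity) ?_
  refine (lintegral_natCast_le (g := fun _ => (conductorBound m L : ℝ≥0∞)) measurable_const
    hm hL hmL (fun A hA => ?_) fun A l _ hA => ?_).trans ?_
  · exact_mod_cast conductor_le (mem_closure_of_notMem_missesBeyond hA)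
  · exact (conductor_le (mem_closure_of_notMem_missesBeyond hA)).trans (by omega)
  · rw [lintegral_const, measure_univ, mul_one, ENNReal.ofReal_add (by positivity) hD,
      ENNReal.ofReal_natCast]

theorem integral_embeddingDim_le (hm : 1 ≤ (p : ℝ) * m) (hL : 0 < L)
    (hmL : ∀ l, L ≤ l → (m : ℝ) ^ 2 ≤ (4 / 3) ^ l) :
    Integrable (fun A => (embeddingDim (AddSubmonoid.closure A) : ℝ)) (generatorLaw p) ∧
    ∫ A, (embeddingDim (AddSubmonoid.closure A) : ℝ) ∂(generatorLaw p) ≤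
      p * (2 * conductorBound m L) + ∑' l, tailTerm l := by
  have hD : 0 ≤ ∑' l, tailTerm l := tsum_nonneg tailTerm_nonneg
  have hp0 : (0 : ℝ) ≤ p := p.2.1
  have hpos : ∀ l, 0 < l → 0 < conductorBound m l := by
    intro l hl
    have hm0 : 0 < m := by
      rcases Nat.eq_zero_or_pos m with rfl | h
      · norm_num at hm
      · exact h
    unfold conductorBound
    positivity
  have hle : ∀ A l, 0 < l → A ∉ missesBeyond (conductorBound m l) →
      embeddingDim (AddSubmonoid.closure A) ≤ (A ∩ Set.Iio (2 * conductorBound m l)).ncard :=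
    fun A l hl hA => embeddingDim_closure_le (hpos l hl) (mem_closure_of_notMem_missesBeyond hA)
  obtain ⟨hgm, hgi⟩ := lintegral_ncard_inter_Iio_le p (2 * conductorBound m L)
  refine integrable_natCast_of_lintegral_le measurable_embeddingDim_closure (by positivity) ?_
  refine (lintegral_natCast_le hgm hm hL hmL (fun A hA => ?_) fun A l hl hA => ?_).trans ?_
  · exact_mod_cast hle A L hL hA
  · refine (hle A l hl hA).trans ?_
    simpa using Set.ncard_le_ncard (Set.inter_subset_right (s := A)
      (t := Set.Iio (2 * conductorBound m l))) (Set.finite_Iio _)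
  · rw [ENNReal.ofReal_add (by positivity) hD]
    gcongr
    exact_mod_cast hgi

end TailSum

/-! ### Comparison of genus and Frobenius number -/

section GenusFrobenius

theorem generatorLaw_real_forall_notMem (p : I) (G : Finset ℕ) (hG : ∀ g ∈ G, 0 < g) :
    MeasurableSet[eventsOn G] {A : Set ℕ | ∀ g ∈ G, g ∉ A} ∧
    (generatorLaw p).real {A : Set ℕ | ∀ g ∈ G, g ∉ A} = (1 - p : ℝ) ^ G.card := by
  classical
  induction G using Finset.induction_on with
  | empty => simp
  | insert g G hg ih =>
    simp only [Finset.mem_insert, forall_eq_or_imp] at hG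
    obtain ⟨ihm, ihp⟩ := ih hG.2
    have hset : {A : Set ℕ | ∀ g' ∈ insert g G, g' ∉ A} =
        {A | g ∉ A} ∩ {A : Set ℕ | ∀ g ∈ G, g ∉ A} := by
      ext A; simp
    rw [hset]
    refine ⟨(measurableSet_eventsOn_notMem (by simp)).inter (eventsOn_mono (by simp) _ ihm), ?_⟩
    rw [generatorLaw_real_inter p (S := {g}) (by simpa using hg)
      (measurableSet_eventsOn_notMem (Set.mem_singleton g)) ihm, ihp,
      generatorLaw_real_notMem p hG.1, Finset.card_insert_of_notMem hg, pow_succ']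

/-- The event that `A` contains `k` and is disjoint from `G`. -/
def hitsAvoiding (k : ℕ) (G : Finset ℕ) : Set (Set ℕ) := {A | k ∈ A} ∩ {A | ∀ g ∈ G, g ∉ A}

theorem hitsAvoiding_prob (p : I) {k : ℕ} (hk : 0 < k) {G : Finset ℕ} (hG : ∀ g ∈ G, 0 < g)
    (hkG : k ∉ G) : MeasurableSet (hitsAvoiding k G) ∧
      (generatorLaw p).real (hitsAvoiding k G) = p * (1 - p : ℝ) ^ G.card := by
  obtain ⟨h1, h2⟩ := generatorLaw_real_forall_notMem p G hG
  refine ⟨(measurableSet_setOfPred.2 (measurable_set_mem k)).inter (eventsOn_le _ _ h1), ?_⟩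
  rw [hitsAvoiding, generatorLaw_real_inter p (S := {k}) (by simpa using hkG)
    (measurableSet_eventsOn_mem (Set.mem_singleton k)) h1, h2, generatorLaw_real_mem p hk]

theorem closure_induction_nat {A : Set ℕ} {P : ℕ → Prop} (h0 : P 0) (hA : ∀ a ∈ A, P a)
    (hadd : ∀ x y, P x → P y → P (x + y)) {n : ℕ} (hn : n ∈ AddSubmonoid.closure A) : P n := by
  induction hn using AddSubmonoid.closure_induction with
  | mem x hx => exact hA x hx
  | zero => exact h0
  | add x y _ _ hx hy => exact hadd x y hx hy

theorem genus_add_card_le_conductor {S : AddSubmonoid ℕ} (hS : IsNumericalSemigroup S)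
    {T : Finset ℕ} (hT : ∀ t ∈ T, t ∈ S ∧ t < conductor S) :
    genus S + T.card ≤ conductor S := by
  have hsub : gaps S ∪ T ⊆ Set.Iio (conductor S) :=
    Set.union_subset (gaps_subset_Iio hS) fun t ht => (hT t ht).2
  have hd : Disjoint (gaps S) T := by
    rw [Set.disjoint_left]
    exact fun t ht ht' => ht (hT t ht').1
  have := Set.ncard_le_ncard hsub (Set.finite_Iio _)
  rw [Set.ncard_union_eq hd hS T.finite_toSet, Set.ncard_coe_finset] at this
  simpa [genus] using this

/-- Sums of elements of `A` are `0`, `k` or at least 6, so 5 is a gap, and `0` and `k` are two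
non-gaps below the conductor. -/
theorem genus_add_two_le_conductor {A : Set ℕ}
    (hS : IsNumericalSemigroup (AddSubmonoid.closure A)) {k : ℕ} (hk : k = 3 ∨ k = 4)
    (hkA : k ∈ A) (h : ∀ g ∈ A, g = 0 ∨ g = k ∨ 6 ≤ g) :
    genus (AddSubmonoid.closure A) + 2 ≤ conductor (AddSubmonoid.closure A) := by
  have h5 : 5 ∉ AddSubmonoid.closure A := by
    intro h5
    have := closure_induction_nat (P := fun x => x = 0 ∨ x = k ∨ 6 ≤ x) (by simp) h
      (fun x y hx hy => by omega) h5
    omega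
  have hc := (lt_conductor_iff hS).2 ⟨5, le_rfl, h5⟩
  have := genus_add_card_le_conductor hS (T := {0, k}) (by
    simp only [Finset.mem_insert, Finset.mem_singleton, forall_eq_or_imp, forall_eq]
    exact ⟨⟨zero_mem _, by omega⟩, AddSubmonoid.subset_closure hkA, by omega⟩)
  rwa [Finset.card_pair (by omega)] at this

theorem genus_add_one_le_conductor {A : Set ℕ}
    (hS : IsNumericalSemigroup (AddSubmonoid.closure A)) (h1 : 1 ∉ A) :
    genus (AddSubmonoid.closure A) + 1 ≤ conductor (AddSubmonoid.closure A) := by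
  have h1' : 1 ∉ AddSubmonoid.closure A := by
    intro h
    have := closure_induction_nat (P := fun x => x ≠ 1) (by simp)
      (fun a ha h => h1 (h ▸ ha)) (fun x y hx hy => by omega) h
    exact this rfl
  have hc := (lt_conductor_iff hS).2 ⟨1, le_rfl, h1'⟩
  simpa using genus_add_card_le_conductor hS (T := {0})
    (by simp only [Finset.mem_singleton, forall_eq]; exact ⟨zero_mem _, by omega⟩)

/-- The right side is `F - g`. It is at least `-1` always, at least `0` if `1 ∉ A`, and at least `1`
if `A` meets `{1, …, 5}` only in 3 or only in 4. -/
theorem indicators_le_conductor_sub_genus {A : Set ℕ}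
    (hS : IsNumericalSemigroup (AddSubmonoid.closure A)) :
    (hitsAvoiding 3 {1, 2, 4, 5}).indicator (fun _ => (1 : ℝ)) A +
      (hitsAvoiding 4 {1, 2, 3, 5}).indicator (fun _ => (1 : ℝ)) A -
      {A : Set ℕ | 1 ∈ A}.indicator (fun _ => (1 : ℝ)) A ≤
    (conductor (AddSubmonoid.closure A) : ℝ) - 1 - genus (AddSubmonoid.closure A) := by
  classical
  have key : ∀ k, k = 3 ∨ k = 4 → ∀ G : Finset ℕ, (∀ x, x = 0 ∨ x = k ∨ 6 ≤ x ∨ x ∈ G) →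
      A ∈ hitsAvoiding k G →
      (genus (AddSubmonoid.closure A) : ℝ) + 2 ≤ conductor (AddSubmonoid.closure A) := by
    intro k hk G hG hA
    have := genus_add_two_le_conductor hS hk hA.1 fun g hg => by
      have h1 := hG g
      have h2 : g ∉ G := fun h => hA.2 g h hg
      tauto
    exact_mod_cast this
  have h3 := key 3 (by simp) {1, 2, 4, 5} (fun x => by
    simp only [Finset.mem_insert, Finset.mem_singleton]; omega)
  have h4 := key 4 (by simp) {1, 2, 3, 5} (fun x => by
    simp only [Finset.mem_insert, Finset.mem_singleton]; omega)
  have h34 : A ∈ hitsAvoiding 3 {1, 2, 4, 5} → A ∉ hitsAvoiding 4 {1, 2, 3, 5} :=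
    fun h h' => h'.2 3 (by simp) h.1
  have h31 : A ∈ hitsAvoiding 3 {1, 2, 4, 5} → 1 ∉ A := fun h => h.2 1 (by simp)
  have h41 : A ∈ hitsAvoiding 4 {1, 2, 3, 5} → 1 ∉ A := fun h => h.2 1 (by simp)
  have h0 : (genus (AddSubmonoid.closure A) : ℝ) ≤ conductor (AddSubmonoid.closure A) := by
    exact_mod_cast genus_le_conductor hS
  have h1 : 1 ∉ A →
      (genus (AddSubmonoid.closure A) : ℝ) + 1 ≤ conductor (AddSubmonoid.closure A) :=
    fun h => by exact_mod_cast genus_add_one_le_conductor hS h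
  simp only [Set.indicator_apply, Set.mem_ofPred]
  by_cases hA3 : A ∈ hitsAvoiding 3 {1, 2, 4, 5}
  · have := h3 hA3
    simp only [hA3, h34 hA3, h31 hA3, if_true, if_false]
    linarith
  by_cases hA4 : A ∈ hitsAvoiding 4 {1, 2, 3, 5}
  · have := h4 hA4
    simp only [hA3, hA4, h41 hA4, if_true, if_false]
    linarith
  by_cases hA1 : 1 ∈ A
  · simp only [hA3, hA4, hA1, if_true, if_false]
    linarith
  · have := h1 hA1
    simp only [hA3, hA4, hA1, if_false]
    linarith

theorem integral_genus_le_integral_conductor {p : I} (hp : (p : ℝ) ≤ 1 / 10)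
    (hS : ∀ᵐ A ∂(generatorLaw p), IsNumericalSemigroup (AddSubmonoid.closure A))
    (hc : Integrable (fun A => (conductor (AddSubmonoid.closure A) : ℝ)) (generatorLaw p))
    (hg : Integrable (fun A => (genus (AddSubmonoid.closure A) : ℝ)) (generatorLaw p)) :
    ∫ A, (genus (AddSubmonoid.closure A) : ℝ) ∂(generatorLaw p) ≤
      ∫ A, ((conductor (AddSubmonoid.closure A) : ℝ) - 1) ∂(generatorLaw p) := by
  have hp0 : (0 : ℝ) ≤ p := p.2.1
  obtain ⟨m3, e3⟩ := hitsAvoiding_prob p (k := 3) (by norm_num) (G := {1, 2, 4, 5}) (by simp)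
    (by simp)
  obtain ⟨m4, e4⟩ := hitsAvoiding_prob p (k := 4) (by norm_num) (G := {1, 2, 3, 5}) (by simp)
    (by simp)
  have m1 : MeasurableSet {A : Set ℕ | 1 ∈ A} := measurableSet_setOfPred.2 (measurable_set_mem 1)
  have i3 := (integrable_const (μ := generatorLaw p) (1 : ℝ)).indicator m3
  have i4 := (integrable_const (μ := generatorLaw p) (1 : ℝ)).indicator m4
  have i1 := (integrable_const (μ := generatorLaw p) (1 : ℝ)).indicator m1
  have hc1 : Integrable (fun A => (conductor (AddSubmonoid.closure A) : ℝ) - 1)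
    (generatorLaw p) := hc.sub (integrable_const 1)
  have hle := integral_mono_ae ((i3.add i4).sub i1) (hc1.sub hg) (by
    filter_upwards [hS] with A hA
    exact indicators_le_conductor_sub_genus hA)
  rw [integral_sub' (i3.add i4) i1, integral_add' i3 i4, integral_sub' hc1 hg,
    integral_indicator_const _ m3, integral_indicator_const _ m4, integral_indicator_const _ m1,
    e3, e4, generatorLaw_real_mem p one_pos] at hle
  have hcard3 : ({1, 2, 4, 5} : Finset ℕ).card = 4 := rfl
  have hcard4 : ({1, 2, 3, 5} : Finset ℕ).card = 4 := rfl
  rw [hcard3, hcard4] at hle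
  simp only [smul_eq_mul, mul_one] at hle
  -- This makes the expected lower bound `2p(1 - p)⁴ - p` nonnegative.
  have hbern : 1 / 2 ≤ (1 - p : ℝ) ^ 4 := by
    have := one_add_mul_le_pow (a := -(p : ℝ)) (by linarith) 4
    rw [← sub_eq_add_neg] at this
    push_cast at this
    linarith
  nlinarith

end GenusFrobenius

/-! ### Choice of scales and the asymptotics -/

section Main

theorem ceil_inv_sq_le {m l : ℕ} (hm : 0 < m) (hl : ⌈8 * Real.log m⌉₊ + 1 ≤ l) :
    (m : ℝ) ^ 2 ≤ (4 / 3) ^ l := by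
  have hm' : (0 : ℝ) < m := by exact_mod_cast hm
  have h1 : 8 * Real.log m ≤ l :=
    (Nat.le_ceil _).trans (by exact_mod_cast (Nat.le_succ _).trans hl)
  -- This explains the 8 in `L`: `l ≥ 8 log m` gives `m ^ 2 ≤ exp (l / 4)`.
  have h43 : Real.exp (1 / 4) ≤ 4 / 3 := by
    have h := Real.add_one_le_exp (-(1 / 4) : ℝ)
    rw [Real.exp_neg] at h
    have := inv_anti₀ (by norm_num) h
    rw [inv_inv] at this
    norm_num at this ⊢
    exact this
  calc (m : ℝ) ^ 2 = Real.exp (2 * Real.log m) := by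
        rw [mul_comm, Real.exp_mul, Real.exp_log hm']; norm_num
    _ ≤ Real.exp (l * (1 / 4)) := Real.exp_le_exp.2 (by linarith)
    _ = Real.exp (1 / 4) ^ l := Real.exp_nat_mul _ _
    _ ≤ _ := by gcongr

theorem one_le_mul_ceil_inv {p : I} (hp : 0 < p) : 1 ≤ (p : ℝ) * ⌈1 / (p : ℝ)⌉₊ := by
  have hp' : (0 : ℝ) < p := hp
  calc (1 : ℝ) = p * (1 / p) := by field_simp
    _ ≤ _ := by gcongr; exact Nat.le_ceil _

theorem expectation_bounds {p : I} (hp : 0 < p) {m L : ℕ} (hm : m = ⌈1 / (p : ℝ)⌉₊)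
    (hL : L = ⌈8 * Real.log m⌉₊ + 1) :
    (∀ᵐ A ∂(generatorLaw p), IsNumericalSemigroup (AddSubmonoid.closure A)) ∧
    (Integrable (fun A => (conductor (AddSubmonoid.closure A) : ℝ)) (generatorLaw p) ∧
      ∫ A, (conductor (AddSubmonoid.closure A) : ℝ) ∂(generatorLaw p) ≤
        conductorBound m L + ∑' l, tailTerm l) ∧
    (Integrable (fun A => (embeddingDim (AddSubmonoid.closure A) : ℝ)) (generatorLaw p) ∧
      ∫ A, (embeddingDim (AddSubmonoid.closure A) : ℝ) ∂(generatorLaw p) ≤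
        p * (2 * conductorBound m L) + ∑' l, tailTerm l) := by
  have hp' : (0 : ℝ) < p := hp
  have hm1 : 1 ≤ (p : ℝ) * m := by rw [hm]; exact one_le_mul_ceil_inv hp
  have hm0 : 0 < m := by rw [hm]; exact Nat.ceil_pos.2 (by positivity)
  have hmL : ∀ l, L ≤ l → (m : ℝ) ^ 2 ≤ (4 / 3) ^ l := fun l hl =>
    ceil_inv_sq_le hm0 (hL ▸ hl)
  exact ⟨ae_isNumericalSemigroup hm1 (by omega) hmL, integral_conductor_le hm1 (by omega) hmL,
    integral_embeddingDim_le hm1 (by omega) hmL⟩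

theorem integrable_genus {p : I} (hp : 0 < p) :
    Integrable (fun A => (genus (AddSubmonoid.closure A) : ℝ)) (generatorLaw p) := by
  obtain ⟨hS, ⟨hc, -⟩, -⟩ := expectation_bounds hp rfl rfl
  refine hc.mono' (measurable_from_nat.comp measurable_genus_closure).aestronglyMeasurable ?_
  filter_upwards [hS] with A hA
  rw [Real.norm_natCast]
  exact_mod_cast genus_le_conductor hA

theorem frobenius_ae_eq {p : I} (hp : 0 < p) :
    (fun A => (frobenius (AddSubmonoid.closure A) : ℝ)) =ᵐ[generatorLaw p]
      fun A => (conductor (AddSubmonoid.closure A) : ℝ) - 1 := by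
  filter_upwards [(expectation_bounds hp rfl rfl).1] with A hA
  rw [frobenius_eq_conductor_sub_one hA]
  push_cast
  rfl

theorem conductorBound_le_of_small {p : ℝ} (hp0 : 0 < p) (hp : p ≤ 1 / 10) {m L : ℕ}
    (hm : m = ⌈1 / p⌉₊) (hL : L = ⌈8 * Real.log m⌉₊ + 1) :
    1 ≤ Real.log (1 / p) ∧
      (conductorBound m L : ℝ) ≤ 50761728 * (1 / p * Real.log (1 / p) ^ 3) := by
  have h10 : 10 ≤ 1 / p := by rw [le_div_iff₀ hp0]; linarith
  have hl1 : 1 ≤ Real.log (1 / p) := by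
    rw [Real.le_log_iff_exp_le (by positivity)]
    linarith [Real.exp_one_lt_d9]
  have hm2 : (m : ℝ) ≤ 2 * (1 / p) := by
    have := Nat.ceil_lt_add_one (show 0 ≤ 1 / p by positivity)
    rw [hm]
    linarith
  have hm0 : (0 : ℝ) < m := by
    rw [hm]; exact_mod_cast Nat.ceil_pos.2 (show 0 < 1 / p by positivity)
  have hlogm : Real.log m ≤ 2 * Real.log (1 / p) := by
    calc Real.log m ≤ Real.log (2 * (1 / p)) := Real.log_le_log hm0 hm2
      _ = Real.log 2 + Real.log (1 / p) := Real.log_mul (by norm_num) (by positivity)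
      _ ≤ _ := by linarith [Real.log_two_lt_d9]
  have hm1 : (1 : ℝ) ≤ m := by exact_mod_cast (Nat.cast_pos.1 hm0 : 0 < m)
  -- `8 * 2` from the logarithm of `m`, plus 2 for the rounding and the added 1. Then `50761728 =
  -- 4352 * 2 * 18 ^ 3`.
  have hLle : (L : ℝ) ≤ 18 * Real.log (1 / p) := by
    have := Nat.ceil_lt_add_one (mul_nonneg (by norm_num : (0 : ℝ) ≤ 8) (Real.log_nonneg hm1))
    rw [hL]
    push_cast
    linarith
  refine ⟨hl1, ?_⟩
  calc (conductorBound m L : ℝ) = 4352 * m * (L : ℝ) ^ 3 := by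
        rw [conductorBound]; push_cast; ring
    _ ≤ 4352 * (2 * (1 / p)) * (18 * Real.log (1 / p)) ^ 3 := by gcongr
    _ = _ := by ring

theorem eventually_small : ∀ᶠ p : I in 𝓝[>] (0 : I), 0 < p ∧ (p : ℝ) ≤ 1 / 10 := by
  refine Filter.Eventually.and self_mem_nhdsWithin (mem_nhdsWithin_of_mem_nhds ?_)
  have h : Tendsto (fun p : I => (p : ℝ)) (𝓝 0) (𝓝 0) := continuous_subtype_val.tendsto 0
  exact h.eventually_le_const (by norm_num)

end Main

end RandomSemigroup

open RandomSemigroup in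
theorem theorem1p4 :
    -- the random semigroup is almost surely a numerical semigroup, and the expectations exist
    (∀ p : I, 0 < p → p < 1 →
      (∀ᵐ A ∂(RandomSemigroup.generatorLaw p),
        RandomSemigroup.IsNumericalSemigroup (AddSubmonoid.closure A)) ∧
      Integrable (fun A : Set ℕ =>
        (RandomSemigroup.embeddingDim (AddSubmonoid.closure A) : ℝ))
        (RandomSemigroup.generatorLaw p) ∧
      Integrable (fun A : Set ℕ =>
        (RandomSemigroup.genus (AddSubmonoid.closure A) : ℝ))
        (RandomSemigroup.generatorLaw p) ∧
      Integrable (fun A : Set ℕ =>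
        (RandomSemigroup.frobenius (AddSubmonoid.closure A) : ℝ))
        (RandomSemigroup.generatorLaw p)) ∧
    -- the asymptotic bounds as `p` tends to `0` from the right
    RandomSemigroup.expectedEmbeddingDim =O[𝓝[>] (0 : I)]
      (fun p : I => Real.log (1 / (p : ℝ)) ^ 3) ∧
    (∀ᶠ p in 𝓝[>] (0 : I),
      RandomSemigroup.expectedGenus p ≤ RandomSemigroup.expectedFrobenius p) ∧
    RandomSemigroup.expectedFrobenius =O[𝓝[>] (0 : I)]
      (fun p : I => 1 / (p : ℝ) * Real.log (1 / (p : ℝ)) ^ 3) := by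
  have hD : 0 ≤ ∑' l, tailTerm l := tsum_nonneg tailTerm_nonneg
  refine ⟨fun p hp _ => ?_, ?_, ?_, ?_⟩
  · obtain ⟨hS, ⟨hc, -⟩, he, -⟩ := expectation_bounds hp rfl rfl
    exact ⟨hS, he, integrable_genus hp,
      (hc.sub (integrable_const 1)).congr (frobenius_ae_eq hp).symm⟩
  · refine IsBigO.of_bound (2 * 50761728 + ∑' l, tailTerm l) ?_
    filter_upwards [eventually_small] with p ⟨hp, hp10⟩
    have hp' : (0 : ℝ) < p := hp
    obtain ⟨hlog, hcb⟩ := conductorBound_le_of_small hp' hp10 rfl rfl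
    obtain ⟨-, -, -, hb⟩ := expectation_bounds hp rfl rfl
    have hl3 : 1 ≤ Real.log (1 / (p : ℝ)) ^ 3 := one_le_pow₀ hlog
    rw [expectedEmbeddingDim, Real.norm_of_nonneg (integral_nonneg fun A => Nat.cast_nonneg _),
      Real.norm_of_nonneg (by positivity)]
    refine hb.trans ?_
    have h1 := mul_le_mul_of_nonneg_left hcb hp'.le
    have h2 : (p : ℝ) * (50761728 * (1 / (p : ℝ) * Real.log (1 / (p : ℝ)) ^ 3)) =
        50761728 * Real.log (1 / (p : ℝ)) ^ 3 := by field_simp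
    have h3 := mul_le_mul_of_nonneg_left hl3 hD
    linarith
  · filter_upwards [eventually_small] with p ⟨hp, hp10⟩
    obtain ⟨hS, ⟨hc, -⟩, -⟩ := expectation_bounds hp rfl rfl
    rw [expectedFrobenius, integral_congr_ae (frobenius_ae_eq hp)]
    exact integral_genus_le_integral_conductor hp10 hS hc (integrable_genus hp)
  -- The added 1 gives room for the lower bound `-1` on the expectation in the absolute value.
  · refine IsBigO.of_bound (50761728 + ∑' l, tailTerm l + 1) ?_
    filter_upwards [eventually_small] with p ⟨hp, hp10⟩
    have hp' : (0 : ℝ) < p := hp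
    obtain ⟨hlog, hcb⟩ := conductorBound_le_of_small hp' hp10 rfl rfl
    obtain ⟨-, ⟨hc, hb⟩, -⟩ := expectation_bounds hp rfl rfl
    have hinv : 1 ≤ 1 / (p : ℝ) := by rw [le_div_iff₀ hp']; linarith
    have hl3 : 1 ≤ 1 / (p : ℝ) * Real.log (1 / (p : ℝ)) ^ 3 :=
      one_le_mul_of_one_le_of_one_le hinv (one_le_pow₀ hlog)
    have hc0 : 0 ≤ ∫ A, (conductor (AddSubmonoid.closure A) : ℝ) ∂(generatorLaw p) :=
      integral_nonneg fun A => Nat.cast_nonneg _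
    rw [expectedFrobenius, integral_congr_ae (frobenius_ae_eq hp),
      integral_sub hc (integrable_const 1), integral_const, probReal_univ, one_smul,
      Real.norm_eq_abs, Real.norm_of_nonneg (by positivity), abs_le]
    have h3 := mul_le_mul_of_nonneg_left hl3 hD
    constructor <;> linarith
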